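/- Let $T$ be a tree on a vertex set $V$ with $|V| = n \ge 3$, with positive real edge weights. Colour a 3-element subset of $V$ red if one of its points lies on the shortest (in $T$: the unique) path between the other two, and blue otherwise. For distinct $u, v \in V$ let the red line of $u,v$ be $R(uv) = \{u,v\} \cup \{p : \{u,v,p\} \text{ is a red triple}\}$ and the blue line be $B(uv) = \{u,v\} \cup \{p : \{u,v,p\} \text{ is a blue triple}\}$. Let $m$ be the number of distinct sets of the form $R(uv)$ plus the number of distinct sets of the form $B(uv)$ (a set that is both a red and a blue line is counted twice). Then $$m \ge \begin{cases} \left\lfloor \frac{n^2}{4} + n + 1 \right\rfloor & \text{if } n \ge 6, \\ \binom{n}{2} + 1 & \text{if } n \le 6 \end{cases}$$ (for $n = 6$ the two bounds coincide). Equality holds if and only if (1) $n \le 6$ and $T$ is a path, or (2) $n \ge 6$ and $T$ is isomorphic to $S(a^*, n - a^*)$, where $a^* = (n-1)/2$ if $n$ is odd, and $a^* = n/2 - 1$ or $a^* = n/2$ if $n$ is even. Here $S(p,q)$ denotes the tree on $p + q$ vertices that consists of a path on $q$ vertices and $p$ further leaves, all attached to the same end of the path. -/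

import Mathlib

/-- The two colours of a bi-coloured system. -/
inductive Colour where
  | red
  | blue

/-- A bi-coloured system on the point set `V`: a colouring of all 3-element subsets of `V`. -/
structure BicolouredSystem (V : Type*) where
  colour : {s : Set V // s.ncard = 3} → Colour

namespace BicolouredSystem

variable {V : Type*}

/-- The line of colour `κ` generated by `u` and `v`: the points `u`, `v`, and all `p` such that
`{u, v, p}` is a triple of colour `κ`. -/
def line (S : BicolouredSystem V) (κ : Colour) (u v : V) : Set V :=
  {u, v} ∪ {p | ∃ h : ({u, v, p} : Set V).ncard = 3, S.colour ⟨{u, v, p}, h⟩ = κ}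

/-- The set of all lines of colour `κ`, generated by pairs of distinct points. -/
def lines (S : BicolouredSystem V) (κ : Colour) : Set (Set V) :=
  {L | ∃ u v : V, u ≠ v ∧ L = S.line κ u v}

/-- The number of distinct red lines plus the number of distinct blue lines (a set that is both a
red line and a blue line is counted twice). -/
noncomputable def numLines (S : BicolouredSystem V) : ℕ :=
  (S.lines Colour.red).ncard + (S.lines Colour.blue).ncard

end BicolouredSystem

namespace SimpleGraph

variable {V : Type*}

/-- The length of a walk with respect to edge weights `w`. -/
def Walk.weight {G : SimpleGraph V} (w : Sym2 V → ℝ) {x y : V} (p : G.Walk x y) : ℝ :=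
  (p.edges.map w).sum

/-- `p` is a shortest path between its ends in the graph with edge weights `w`. -/
def Walk.IsShortestPath {G : SimpleGraph V} (w : Sym2 V → ℝ) {x y : V} (p : G.Walk x y) : Prop :=
  p.IsPath ∧ ∀ q : G.Walk x y, q.IsPath → p.weight w ≤ q.weight w

/-- One of the points of the triple `s` lies on a shortest path between the other two. -/
def IsCollinearTriple (G : SimpleGraph V) (w : Sym2 V → ℝ) (s : Set V) : Prop :=
  ∃ x y z : V, s = {x, y, z} ∧ ∃ p : G.Walk x z, p.IsShortestPath w ∧ y ∈ p.support

open Classical in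
/-- The bi-coloured system derived from a graph with edge weights `w` (only the values of `w` on
the edges matter): a triple is red iff one of its points lies on a shortest path between the
other two. -/
noncomputable def derivedSystem (G : SimpleGraph V) (w : Sym2 V → ℝ) : BicolouredSystem V where
  colour s := if G.IsCollinearTriple w s.1 then Colour.red else Colour.blue

/-- The tree `S(p, q)`: a path on the `q` vertices `inr 0, …, inr (q - 1)`, with `p` leaves
`inl i` attached to its end `inr 0`. -/
def broom (p q : ℕ) : SimpleGraph (Fin p ⊕ Fin q) :=
  SimpleGraph.fromRel fun
    | Sum.inl _, Sum.inr j => j.val = 0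
    | Sum.inr i, Sum.inr j => i.val + 1 = j.val
    | _, _ => False

/-- `G` is a path on `n` vertices. -/
def IsPathOn (G : SimpleGraph V) (n : ℕ) : Prop :=
  Nonempty (G ≃g SimpleGraph.pathGraph n)

/-- `G` is `S(a, n - a)` with `a = (n - 1) / 2` if `n` is odd, and `a = n / 2 - 1` or `a = n / 2`
if `n` is even. -/
def IsBalancedBroom (G : SimpleGraph V) (n : ℕ) : Prop :=
  ∃ a : ℕ, ((Odd n ∧ a = (n - 1) / 2) ∨ (Even n ∧ (a = n / 2 - 1 ∨ a = n / 2))) ∧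
    Nonempty (G ≃g SimpleGraph.broom a (n - a))

end SimpleGraph

/-!
In a tree a triple is red exactly when it is collinear for the path metric.

Red lines: two leaves `u`, `v` generate a red line whose only leaves are `u` and `v`, and an edge
generates the whole vertex set. A tree with `ℓ ≥ 3` leaves therefore has at least `ℓ.choose 2 + 1`
red lines.

Blue lines can be counted exactly. Call two leaves twins when they hang from the same vertex, and
let `N` be the number of vertices left out when one representative of each twin class is kept. Pairs
of distinct representatives generate pairwise distinct blue lines. The only others are the `N`
edges `{l, x}` at a leaf `l` left out, and, for each vertex `x` carrying at least two leaves, the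
complement of `x`, which is generated by any two of these leaves.

A tree with at most two leaves is a path and has `n.choose 2 + 1` lines. If a tree has at least
three leaves and either no twins or all its leaves at one vertex (a star), it has more than that.
In every other tree `ℓ ≥ N + 2`, so it has at least
`broomLines n N = (N + 2).choose 2 + 1 + ((n - N).choose 2 + N + 1)` lines, with equality only for
the broom `S(N + 1, n - N - 1)`. The identity
`4 * broomLines n s = n ^ 2 + 4 * n + 3 + (n - 2 * s - 3) ^ 2` then singles out the extremal brooms.
-/

namespace TreeLines

open SimpleGraph Finset

section Pairs

variable {α β : Type*} {s : Finset α} {f : α → α → β}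

/-- The values of `f` at pairs of distinct elements of `s`. The lines of one colour are the values
of the corresponding line function at pairs of distinct points. -/
def pairValues (f : α → α → β) (s : Finset α) : Set β :=
  {y | ∃ a ∈ s, ∃ b ∈ s, a ≠ b ∧ y = f a b}

lemma mem_pairValues {a b : α} (ha : a ∈ s) (hb : b ∈ s) (hab : a ≠ b) :
    f a b ∈ pairValues f s :=
  ⟨a, ha, b, hb, hab, rfl⟩

lemma pairValues_eq_image_sym2Lift [DecidableEq α] (hf : ∀ a b, f a b = f b a) :
    pairValues f s = Sym2.lift ⟨f, hf⟩ '' (s.offDiag.image (Function.uncurry Sym2.mk)) := by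
  ext y
  simp [pairValues, and_assoc, eq_comm]

lemma ncard_pairValues (hf : ∀ a b, f a b = f b a)
    (hinj : ∀ a ∈ s, ∀ b ∈ s, ∀ c ∈ s, ∀ d ∈ s, a ≠ b → c ≠ d → f a b = f c d → s(a, b) = s(c, d)) :
    (pairValues f s).ncard = (#s).choose 2 := by
  classical
  rw [pairValues_eq_image_sym2Lift hf, ← Sym2.card_image_offDiag, ← Set.ncard_coe_finset]
  refine Set.InjOn.ncard_image fun e he e' he' h => ?_
  obtain ⟨⟨a, b⟩, hab, rfl⟩ := Finset.mem_image.1 he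
  obtain ⟨⟨c, d⟩, hcd, rfl⟩ := Finset.mem_image.1 he'
  rw [mem_offDiag] at hab hcd
  exact hinj a hab.1 b hab.2.1 c hcd.1 d hcd.2.1 hab.2.2 hcd.2.2 h

end Pairs

section Metric

variable {V : Type*} {T : SimpleGraph V} {a b p q u v w x y z : V}

/-- The point `p` lies between `u` and `v` in the metric `T.dist`; in a tree this says that `p` lies
on the path from `u` to `v`. -/
def IsBetween (T : SimpleGraph V) (u p v : V) : Prop :=
  T.dist u p + T.dist p v = T.dist u v

/-- One of `u`, `v`, `p` lies between the other two, which for distinct points means that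
`{u, v, p}` is a red triple. -/
def IsCollinear (T : SimpleGraph V) (u v p : V) : Prop :=
  IsBetween T u p v ∨ IsBetween T p u v ∨ IsBetween T u v p

lemma isBetween_left (u v : V) : IsBetween T u u v := by simp [IsBetween]

lemma isBetween_right (u v : V) : IsBetween T u v v := by simp [IsBetween]

lemma IsBetween.symm (h : IsBetween T u p v) : IsBetween T v p u := by
  grind [IsBetween, SimpleGraph.dist_comm]

lemma isCollinear_left (u v : V) : IsCollinear T u v u := .inl (isBetween_left u v)

lemma isCollinear_right (u v : V) : IsCollinear T u v v := .inl (isBetween_right u v)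

lemma isCollinear_comm : IsCollinear T u v p ↔ IsCollinear T v u p := by
  grind [IsCollinear, IsBetween, SimpleGraph.dist_comm]

lemma dist_eq_one_of_adj (h : T.Adj u v) : T.dist u v = 1 :=
  dist_eq_one_iff_adj.2 h

lemma length_eq_dist_of_isPath (hT : T.IsTree) {P : T.Walk u v} (hP : P.IsPath) :
    P.length = T.dist u v := by
  obtain ⟨Q, hQ, hlen⟩ := hT.connected.exists_path_of_dist u v
  rw [(hT.existsUnique_path u v).unique hP hQ, hlen]

lemma mem_support_iff_isBetween (hT : T.IsTree) {P : T.Walk u v} (hP : P.IsPath) :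
    p ∈ P.support ↔ IsBetween T u p v := by
  classical
  constructor
  · intro h
    rw [IsBetween, ← length_eq_dist_of_isPath hT (hP.takeUntil h),
      ← length_eq_dist_of_isPath hT (hP.dropUntil h), ← Walk.length_append, P.take_spec h,
      length_eq_dist_of_isPath hT hP]
  · intro h
    obtain ⟨A, -, hA⟩ := hT.connected.exists_path_of_dist u p
    obtain ⟨B, -, hB⟩ := hT.connected.exists_path_of_dist p v
    have hAB : (A.append B).IsPath := by
      apply Walk.isPath_of_length_eq_dist
      rw [Walk.length_append, hA, hB, h]
    rw [(hT.existsUnique_path u v).unique hP hAB, Walk.mem_support_append_iff]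
    exact .inl A.end_mem_support

lemma isBetween_total (hT : T.IsTree) (hp : IsBetween T x p y) (hq : IsBetween T x q y) :
    IsBetween T x p q ∨ IsBetween T x q p := by
  classical
  obtain ⟨P, hP, -⟩ := hT.connected.exists_path_of_dist x y
  have hpP := (mem_support_iff_isBetween hT hP).2 hp
  have hqP := (mem_support_iff_isBetween hT hP).2 hq
  rw [← P.take_spec hpP, Walk.mem_support_append_iff] at hqP
  rcases hqP with hq' | hq'
  · exact .inr ((mem_support_iff_isBetween hT (hP.takeUntil hpP)).1 hq')
  · have hpqy := (mem_support_iff_isBetween hT (hP.dropUntil hpP)).1 hq'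
    left
    unfold IsBetween at *
    lia

lemma dist_add_eq_or_dist_add_eq (hT : T.IsTree) (hp : IsBetween T x p y)
    (hq : IsBetween T x q y) :
    T.dist x p + T.dist p q = T.dist x q ∨ T.dist x q + T.dist p q = T.dist x p := by
  grind [isBetween_total, IsBetween, SimpleGraph.dist_comm]

lemma eq_of_isBetween_of_dist_eq (hT : T.IsTree) (hp : IsBetween T x p y)
    (hq : IsBetween T x q y) (h : T.dist x p = T.dist x q) : p = q := by
  rw [← hT.connected.dist_eq_zero_iff]
  grind [dist_add_eq_or_dist_add_eq]

lemma isCollinear_of_isBetween (hT : T.IsTree) (hu : IsBetween T x u y) (hv : IsBetween T x v y)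
    (hp : IsBetween T x p y) : IsCollinear T u v p := by
  have huv := dist_add_eq_or_dist_add_eq hT hu hv
  have hup := dist_add_eq_or_dist_add_eq hT hu hp
  have hvp := dist_add_eq_or_dist_add_eq hT hv hp
  grind [IsCollinear, IsBetween, SimpleGraph.dist_comm]

lemma IsBetween.trans (hT : T.IsTree) (hu : IsBetween T x u y) (hv : IsBetween T x v y)
    (hp : IsBetween T u p v) : IsBetween T x p y := by
  have huv := dist_add_eq_or_dist_add_eq hT hu hv
  have := hT.connected.dist_triangle (u := x) (v := p) (w := y)
  have := hT.connected.dist_triangle (u := x) (v := u) (w := p)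
  have := hT.connected.dist_triangle (u := p) (v := v) (w := y)
  have := hT.connected.dist_triangle (u := x) (v := v) (w := p)
  have := hT.connected.dist_triangle (u := p) (v := u) (w := y)
  grind [IsBetween, SimpleGraph.dist_comm]

lemma pair_eq_of_isBetween (hT : T.IsTree) (hx : IsBetween T u x v) (hy : IsBetween T u y v)
    (hu : IsBetween T x u y) (hv : IsBetween T x v y) : s(x, y) = s(u, v) := by
  have hxy := dist_add_eq_or_dist_add_eq hT hx hy
  simp only [Sym2.eq_iff, ← hT.connected.dist_eq_zero_iff]
  grind [IsBetween, SimpleGraph.dist_comm]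

lemma isCollinear_of_adj (hT : T.IsTree) (h : T.Adj u v) (p : V) : IsCollinear T u v p := by
  have := hT.dist_eq_dist_add_one_of_adj p h
  have := dist_eq_one_of_adj h
  grind [IsCollinear, IsBetween, SimpleGraph.dist_comm]

lemma isCollinear_right_of_adj (hT : T.IsTree) (h : T.Adj u p) (v : V) : IsCollinear T u v p := by
  have := hT.dist_eq_dist_add_one_of_adj v h
  have := dist_eq_one_of_adj h
  grind [IsCollinear, IsBetween, SimpleGraph.dist_comm]

lemma isBetween_of_adj_of_adj (hT : T.IsTree) (hx : T.Adj u x) (hy : T.Adj u y) (hxy : x ≠ y) :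
    IsBetween T x u y := by
  have := hT.dist_eq_dist_add_one_of_adj x hy
  have := hT.connected.pos_dist_of_ne hxy
  grind [IsBetween, SimpleGraph.dist_comm, dist_eq_one_of_adj]

end Metric

section Lines

variable {V : Type*} {T : SimpleGraph V} {p u v : V}

/-- The red line of `u` and `v`, described through the metric `T.dist`. -/
def redLine (T : SimpleGraph V) (u v : V) : Set V :=
  {p | IsCollinear T u v p}

/-- The blue line of `u` and `v`, described through the metric `T.dist`. -/
def blueLine (T : SimpleGraph V) (u v : V) : Set V :=
  {u, v} ∪ (redLine T u v)ᶜ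

lemma redLine_comm (u v : V) : redLine T u v = redLine T v u :=
  Set.ext fun _ => isCollinear_comm

lemma blueLine_comm (u v : V) : blueLine T u v = blueLine T v u := by
  rw [blueLine, blueLine, redLine_comm, Set.pair_comm]

lemma mem_blueLine : p ∈ blueLine T u v ↔ p = u ∨ p = v ∨ ¬ IsCollinear T u v p :=
  or_assoc

lemma left_mem_blueLine (u v : V) : u ∈ blueLine T u v :=
  mem_blueLine.2 (.inl rfl)

lemma right_mem_blueLine (u v : V) : v ∈ blueLine T u v :=
  mem_blueLine.2 (.inr (.inl rfl))

lemma redLine_of_adj (hT : T.IsTree) (h : T.Adj u v) : redLine T u v = Set.univ :=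
  Set.eq_univ_of_forall (isCollinear_of_adj hT h)

lemma blueLine_of_adj (hT : T.IsTree) (h : T.Adj u v) : blueLine T u v = {u, v} := by
  simp [blueLine, redLine_of_adj hT h]

lemma exists_isShortestPath_iff_isBetween (hT : T.IsTree) (w : Sym2 V → ℝ) :
    (∃ P : T.Walk u v, P.IsShortestPath w ∧ p ∈ P.support) ↔ IsBetween T u p v := by
  constructor
  · rintro ⟨P, hP, hp⟩
    exact (mem_support_iff_isBetween hT hP.1).1 hp
  · intro h
    obtain ⟨P, hP, hunique⟩ := hT.existsUnique_path u v
    exact ⟨P, ⟨hP, fun Q hQ => (congrArg _ (hunique Q hQ)).ge⟩,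
      (mem_support_iff_isBetween hT hP).2 h⟩

lemma isCollinearTriple_iff (hT : T.IsTree) (w : Sym2 V → ℝ) (huv : u ≠ v) (hpu : p ≠ u)
    (hpv : p ≠ v) : T.IsCollinearTriple w {u, v, p} ↔ IsCollinear T u v p := by
  simp only [IsCollinearTriple, exists_isShortestPath_iff_isBetween hT]
  constructor
  · rintro ⟨x, y, z, hs, h⟩
    simp only [Set.ext_iff, Set.mem_insert_iff, Set.mem_singleton_iff] at hs
    have hu := hs u
    have hv := hs v
    have hp := hs p
    clear hs
    grind [IsCollinear, IsBetween.symm]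
  · rintro (h | h | h)
    · exact ⟨u, p, v, by grind, h⟩
    · exact ⟨p, u, v, by grind, h⟩
    · exact ⟨u, v, p, rfl, h⟩

lemma line_red (hT : T.IsTree) (w : Sym2 V → ℝ) (huv : u ≠ v) :
    (T.derivedSystem w).line .red u v = redLine T u v := by
  ext p
  by_cases hpu : p = u
  · simp [BicolouredSystem.line, redLine, hpu, isCollinear_left]
  by_cases hpv : p = v
  · simp [BicolouredSystem.line, redLine, hpv, isCollinear_right]
  have h3 : ({u, v, p} : Set V).ncard = 3 :=
    Set.ncard_eq_three.2 ⟨u, v, p, huv, Ne.symm hpu, Ne.symm hpv, rfl⟩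
  simp [BicolouredSystem.line, derivedSystem, redLine, hpu, hpv, h3,
    isCollinearTriple_iff hT w huv hpu hpv]

lemma line_blue (hT : T.IsTree) (w : Sym2 V → ℝ) (huv : u ≠ v) :
    (T.derivedSystem w).line .blue u v = blueLine T u v := by
  ext p
  by_cases hpu : p = u
  · simp [BicolouredSystem.line, blueLine, hpu]
  by_cases hpv : p = v
  · simp [BicolouredSystem.line, blueLine, hpv]
  have h3 : ({u, v, p} : Set V).ncard = 3 :=
    Set.ncard_eq_three.2 ⟨u, v, p, huv, Ne.symm hpu, Ne.symm hpv, rfl⟩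
  simp [BicolouredSystem.line, derivedSystem, blueLine, redLine, hpu, hpv, h3,
    isCollinearTriple_iff hT w huv hpu hpv]

variable [Fintype V]

lemma lines_eq_pairValues {S : BicolouredSystem V} {κ : Colour} {f : V → V → Set V}
    (hf : ∀ u v, u ≠ v → S.line κ u v = f u v) : S.lines κ = pairValues f univ := by
  ext L
  simp only [BicolouredSystem.lines, pairValues, Set.mem_ofPred_eq, mem_univ, true_and]
  grind

lemma numLines_eq (hT : T.IsTree) (w : Sym2 V → ℝ) : (T.derivedSystem w).numLines =
    (pairValues (redLine T) univ).ncard + (pairValues (blueLine T) univ).ncard := by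
  rw [BicolouredSystem.numLines, lines_eq_pairValues fun _ _ => line_red hT w,
    lines_eq_pairValues fun _ _ => line_blue hT w]

end Lines

section Leaves

variable {V : Type*} {T : SimpleGraph V} {a b l p u v x y z : V}

/-- `l` is a leaf attached to `x`, that is, its only neighbour is `x`. -/
def IsLeafAt (T : SimpleGraph V) (l x : V) : Prop :=
  T.Adj l x ∧ ∀ y, T.Adj l y → y = x

/-- `l` is a leaf. -/
def IsLeaf (T : SimpleGraph V) (l : V) : Prop :=
  ∃ x, IsLeafAt T l x

lemma IsLeafAt.eq (hx : IsLeafAt T l x) (hy : IsLeafAt T l y) : x = y :=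
  hy.2 x hx.1

lemma IsLeafAt.dist_left (hl : IsLeafAt T l x) (hT : T.IsTree) (hu : u ≠ l) :
    T.dist l u = T.dist x u + 1 := by
  obtain ⟨P, hP, hlen⟩ := hT.connected.exists_path_of_dist l u
  cases P with
  | nil => exact absurd rfl hu
  | cons h Q =>
    obtain rfl := hl.2 _ h
    rw [← hlen, Walk.length_cons, length_eq_dist_of_isPath hT hP.of_cons]

lemma IsLeafAt.dist_right (hl : IsLeafAt T l x) (hT : T.IsTree) (hu : u ≠ l) :
    T.dist u l = T.dist u x + 1 := by
  rw [SimpleGraph.dist_comm, hl.dist_left hT hu, SimpleGraph.dist_comm]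

lemma IsLeaf.eq_or_eq_of_isBetween (hl : IsLeaf T l) (hT : T.IsTree) (h : IsBetween T u l v) :
    l = u ∨ l = v := by
  obtain ⟨x, hx⟩ := hl
  have := hT.connected.dist_triangle (u := u) (v := x) (w := v)
  grind [IsBetween, hx.dist_left hT (u := v), hx.dist_right hT (u := u)]

lemma exists_adj_dist_eq_add_one (hT : T.IsTree) (hvz : v ≠ z) (hv : ¬ IsLeaf T v) :
    ∃ t, T.Adj v t ∧ T.dist z t = T.dist z v + 1 := by
  by_contra! hfar
  have hnear : ∀ t, T.Adj v t → T.dist v t = 1 ∧ IsBetween T v t z := fun t ht => by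
    have := hT.dist_eq_dist_add_one_of_adj z ht
    have := dist_eq_one_of_adj ht
    grind [IsBetween, SimpleGraph.dist_comm]
  have : Nontrivial V := ⟨v, z, hvz⟩
  obtain ⟨x, hx⟩ := hT.connected.preconnected.exists_adj_of_nontrivial v
  exact hv ⟨x, hx, fun y hy => eq_of_isBetween_of_dist_eq hT (hnear y hy).2 (hnear x hx).2
    ((hnear y hy).1.trans (hnear x hx).1.symm)⟩

lemma exists_isLeaf_isBetween [Finite V] (hT : T.IsTree) (hvz : v ≠ z) :
    ∃ l, IsLeaf T l ∧ l ≠ z ∧ IsBetween T z v l := by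
  obtain ⟨l, hl, hmax⟩ := (Set.toFinite {l | IsBetween T z v l}).exists_maximalFor
    (T.dist z) _ ⟨v, isBetween_right z v⟩
  simp only [Set.mem_ofPred_eq] at hl hmax
  have hlz : l ≠ z := by
    have := hT.connected.pos_dist_of_ne hvz.symm
    grind [IsBetween]
  refine ⟨l, ?_, hlz, hl⟩
  by_contra hnl
  obtain ⟨t, ht, hd⟩ := exists_adj_dist_eq_add_one hT hlz hnl
  have hlt : IsBetween T z l t := by rw [IsBetween, hd, dist_eq_one_of_adj ht]
  have := @hmax t (.trans hT (isBetween_left z t) hlt hl) (by lia)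
  lia

lemma exists_ne_isLeaf [Finite V] [Nontrivial V] (hT : T.IsTree) :
    ∃ l z, IsLeaf T l ∧ IsLeaf T z ∧ l ≠ z := by
  obtain ⟨u, v, huv⟩ := exists_pair_ne V
  obtain ⟨l, ⟨x, hx⟩, -⟩ := exists_isLeaf_isBetween hT huv
  obtain ⟨z, hz, hzl, -⟩ := exists_isLeaf_isBetween hT hx.1.ne'
  exact ⟨l, z, ⟨x, hx⟩, hz, hzl.symm⟩

end Leaves

section BlueLines

variable {V : Type*} {T : SimpleGraph V} {a b l p r s t u v x y : V}

lemma IsLeafAt.isBetween (hl : IsLeafAt T l x) (hT : T.IsTree) (hpl : p ≠ l)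
    (h : IsBetween T l p v) : IsBetween T x p v := by
  have hvl : v ≠ l := by
    have := hT.connected.pos_dist_of_ne hpl
    grind [IsBetween, SimpleGraph.dist_comm]
  grind [IsBetween, hl.dist_left hT hpl, hl.dist_left hT hvl]

lemma isBetween_of_adj_of_not_isCollinear (hT : T.IsTree) (hut : T.Adj u t)
    (hu : ¬ IsCollinear T a b u) (ht : IsCollinear T a b t) : IsBetween T a t b := by
  have not_beyond : ∀ {a b}, ¬ IsCollinear T a b u → ¬ IsBetween T t a b := by
    intro a b hu ha
    have := hT.dist_eq_dist_add_one_of_adj a hut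
    have := hT.dist_eq_dist_add_one_of_adj b hut
    have := hT.connected.dist_triangle (u := u) (v := a) (w := b)
    have : IsBetween T t u b := by
      grind [IsCollinear, IsBetween, SimpleGraph.dist_comm, dist_eq_one_of_adj]
    have := dist_add_eq_or_dist_add_eq hT ha this
    grind [IsCollinear, IsBetween, SimpleGraph.dist_comm, dist_eq_one_of_adj]
  rcases ht with h | h | h
  · exact h
  · exact absurd h (not_beyond hu)
  · exact absurd h.symm (not_beyond (mt isCollinear_comm.1 hu))

lemma not_isCollinear_of_blueLine_eq (h : blueLine T u v = blueLine T a b) (hua : u ≠ a)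
    (hub : u ≠ b) : ¬ IsCollinear T a b u := by
  have := h ▸ left_mem_blueLine (T := T) u v
  simpa [mem_blueLine, hua, hub] using this

lemma not_adj_of_blueLine_eq (hT : T.IsTree) (h : blueLine T u v = blueLine T a b) (hua : u ≠ a)
    (hub : u ≠ b) : ¬ T.Adj u v := by
  intro huv
  rw [blueLine_of_adj hT huv] at h
  have ha : a ∈ ({u, v} : Set V) := h ▸ left_mem_blueLine a b
  have hb : b ∈ ({u, v} : Set V) := h ▸ right_mem_blueLine a b
  have hu : u ∈ blueLine T a b := h ▸ Set.mem_insert u {v}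
  obtain rfl : a = b := by grind
  simp [mem_blueLine, hua, IsCollinear, isBetween_left] at hu

lemma isBetween_of_adj_of_blueLine_eq (hT : T.IsTree) (h : blueLine T u v = blueLine T a b)
    (hua : u ≠ a) (hub : u ≠ b) (hut : T.Adj u t) : IsBetween T a t b ∧ t ≠ a ∧ t ≠ b := by
  have hu := not_isCollinear_of_blueLine_eq h hua hub
  have hta : t ≠ a := by
    rintro rfl
    exact hu (isCollinear_right_of_adj hT hut.symm b)
  have htb : t ≠ b := by
    rintro rfl
    exact hu (isCollinear_comm.1 (isCollinear_right_of_adj hT hut.symm a))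
  have htv : t ≠ v := by
    rintro rfl
    exact not_adj_of_blueLine_eq hT h hua hub hut
  have ht : t ∉ blueLine T a b := by
    simpa [← h, mem_blueLine, hut.ne', htv] using isCollinear_right_of_adj hT hut v
  rw [mem_blueLine] at ht
  push Not at ht
  exact ⟨isBetween_of_adj_of_not_isCollinear hT hut hu ht.2.2, hta, htb⟩

-- Two neighbours of `u` between `a` and `b` would put `u` between `a` and `b` as well.
lemma exists_isLeafAt_of_blueLine_eq (hT : T.IsTree) (h : blueLine T u v = blueLine T a b)
    (hua : u ≠ a) (hub : u ≠ b) : ∃ x, IsLeafAt T u x ∧ IsBetween T a x b ∧ x ≠ a ∧ x ≠ b := by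
  have hnbr : ∀ t, T.Adj u t → IsBetween T a t b ∧ t ≠ a ∧ t ≠ b :=
    fun t => isBetween_of_adj_of_blueLine_eq hT h hua hub
  have : Nontrivial V := ⟨u, a, hua⟩
  obtain ⟨x, hx⟩ := hT.connected.preconnected.exists_adj_of_nontrivial u
  refine ⟨x, ⟨hx, fun y hy => ?_⟩, hnbr x hx⟩
  by_contra hyx
  exact not_isCollinear_of_blueLine_eq h hua hub
    (.inl (.trans hT (hnbr y hy).1 (hnbr x hx).1 (isBetween_of_adj_of_adj hT hy hx hyx)))

/-- `u` and `v` are equal, or leaves with the same neighbour. -/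
def IsTwin (T : SimpleGraph V) (u v : V) : Prop :=
  u = v ∨ ∃ x, IsLeafAt T u x ∧ IsLeafAt T v x

/-- The equivalence relation of being twins, used to choose one representative from each class of
leaves with a common neighbour. -/
def twinSetoid (T : SimpleGraph V) : Setoid V where
  r := IsTwin T
  iseqv :=
    { refl := fun _ => .inl rfl
      symm := by grind [IsTwin]
      trans := by grind [IsTwin, IsLeafAt.eq] }

/-- The chosen representative of the twin class of `v`. -/
noncomputable def twinRep (T : SimpleGraph V) (v : V) : V :=
  (Quotient.mk (twinSetoid T) v).out

lemma isTwin_twinRep (v : V) : IsTwin T (twinRep T v) v :=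
  Quotient.exact (s := twinSetoid T) (Quotient.out_eq _)

lemma twinRep_eq_twinRep_iff : twinRep T u = twinRep T v ↔ IsTwin T u v :=
  Quotient.out_inj.trans Quotient.eq

lemma twinRep_twinRep (v : V) : twinRep T (twinRep T v) = twinRep T v :=
  twinRep_eq_twinRep_iff.2 (isTwin_twinRep v)

lemma exists_isLeafAt_of_twinRep_ne (h : twinRep T v ≠ v) :
    ∃ x, IsLeafAt T v x ∧ IsLeafAt T (twinRep T v) x := by
  grind [isTwin_twinRep (T := T) v, IsTwin]

lemma isTwin_of_blueLine_eq (hT : T.IsTree) (huv : u ≠ v) (hav : a ≠ v)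
    (h : blueLine T u v = blueLine T a v) : IsTwin T u a := by
  by_cases hua : u = a
  · exact .inl hua
  obtain ⟨x, hux, hx, hxa, -⟩ := exists_isLeafAt_of_blueLine_eq hT h hua huv
  obtain ⟨y, hay, hy, hyu, -⟩ := exists_isLeafAt_of_blueLine_eq hT h.symm (Ne.symm hua) hav
  have hyx := hay.isBetween hT hxa hx
  have hxy := hux.isBetween hT hyu hy
  obtain rfl : x = y := by
    rw [← hT.connected.dist_eq_zero_iff]
    grind [IsBetween, SimpleGraph.dist_comm]
  exact .inr ⟨x, hux, hay⟩

lemma isTwin_pair_of_blueLine_eq (hT : T.IsTree) (hua : u ≠ a) (hub : u ≠ b) (hva : v ≠ a)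
    (hvb : v ≠ b) (h : blueLine T u v = blueLine T a b) :
    IsTwin T u a ∧ IsTwin T v b ∨ IsTwin T u b ∧ IsTwin T v a := by
  have h' : blueLine T v u = blueLine T b a := by rwa [blueLine_comm v, blueLine_comm b]
  obtain ⟨x, hux, hx, hxa, hxb⟩ := exists_isLeafAt_of_blueLine_eq hT h hua hub
  obtain ⟨y, hvy, hy, hyb, hya⟩ := exists_isLeafAt_of_blueLine_eq hT h' hvb hva
  obtain ⟨r, har, hr, hru, hrv⟩ := exists_isLeafAt_of_blueLine_eq hT h.symm hua.symm hva.symm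
  obtain ⟨s, hbs, hs, hsv, hsu⟩ := exists_isLeafAt_of_blueLine_eq hT h'.symm hvb.symm hub.symm
  have inner : ∀ {l m x y p}, IsLeafAt T l x → IsLeafAt T m y → p ≠ l → p ≠ m →
      IsBetween T l p m → IsBetween T x p y := fun hl hm hpl hpm hp =>
    (hm.isBetween hT hpm (hl.isBetween hT hpl hp).symm).symm
  have hpair : s(x, y) = s(r, s) := pair_eq_of_isBetween hT
    (inner har hbs hxa hxb hx) (inner har hbs hya hyb hy.symm)
    (inner hux hvy hru hrv hr) (inner hux hvy hsu hsv hs.symm)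
  rcases Sym2.eq_iff.1 hpair with ⟨rfl, rfl⟩ | ⟨rfl, rfl⟩
  · exact .inl ⟨.inr ⟨x, hux, har⟩, .inr ⟨y, hvy, hbs⟩⟩
  · exact .inr ⟨.inr ⟨x, hux, hbs⟩, .inr ⟨y, hvy, har⟩⟩

lemma twinRep_pair_eq_of_blueLine_eq (hT : T.IsTree) (huv : u ≠ v) (hab : a ≠ b)
    (h : blueLine T u v = blueLine T a b) :
    s(twinRep T u, twinRep T v) = s(twinRep T a, twinRep T b) := by
  simp only [Sym2.eq_iff, twinRep_eq_twinRep_iff]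
  have hrefl : ∀ x, IsTwin T x x := fun x => .inl rfl
  by_cases hua : u = a <;> by_cases hub : u = b <;> by_cases hva : v = a <;>
    by_cases hvb : v = b <;>
    grind [isTwin_of_blueLine_eq, isTwin_pair_of_blueLine_eq, blueLine_comm]

lemma blueLine_eq_of_isLeafAt (hT : T.IsTree) (hu : IsLeafAt T u x) (ha : IsLeafAt T a x)
    (huv : u ≠ v) (hav : a ≠ v) (hvx : v ≠ x) : blueLine T u v = blueLine T a v := by
  obtain rfl | hua := eq_or_ne u a
  · rfl
  have := hu.dist_left hT huv.symm
  have := ha.dist_left hT hav.symm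
  have := hu.dist_left hT hua.symm
  have := dist_eq_one_of_adj ha.1
  have := hT.connected.pos_dist_of_ne hvx
  ext p
  have := hu.dist_left hT (u := p)
  have := ha.dist_left hT (u := p)
  by_cases hpu : p = u <;> by_cases hpa : p = a <;>
    grind [mem_blueLine, IsCollinear, IsBetween, SimpleGraph.dist_comm]

lemma blueLine_of_isLeafAt (hT : T.IsTree) (hu : IsLeafAt T u x) (hv : IsLeafAt T v x)
    (huv : u ≠ v) : blueLine T u v = {x}ᶜ := by
  have := hu.dist_left hT huv.symm
  have := dist_eq_one_of_adj hv.1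
  have := dist_eq_one_of_adj hu.1
  ext p
  have := hu.dist_left hT (u := p)
  have := hv.dist_left hT (u := p)
  have := hT.connected.pos_dist_of_ne (u := p) (v := x)
  grind [mem_blueLine, IsCollinear, IsBetween, SimpleGraph.dist_comm, Adj.ne]

end BlueLines

section BlueCount

variable {V : Type*} {T : SimpleGraph V} {l u v x y : V}

lemma IsLeafAt.neighborSet_eq (h : IsLeafAt T l x) : T.neighborSet l = {x} :=
  Set.ext fun y => ⟨h.2 y, fun hy => hy ▸ h.1⟩

lemma not_isLeaf_of_twinRep_ne (h : twinRep T l ≠ l) (hl : IsLeafAt T l x) : ¬ IsLeaf T x := by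
  rintro ⟨y, -, hy⟩
  obtain ⟨x', hx, hx'⟩ := exists_isLeafAt_of_twinRep_ne h
  obtain rfl := hl.eq hx
  exact h ((hy _ hx'.1.symm).trans (hy _ hl.1.symm).symm)

lemma blueLine_twinRep_left (hT : T.IsTree) (h : twinRep T u ≠ twinRep T v)
    (hu : twinRep T u ≠ u → ¬ IsLeafAt T u v) : blueLine T u v = blueLine T (twinRep T u) v := by
  by_cases hrep : twinRep T u = u
  · rw [hrep]
  obtain ⟨x, hux, hx⟩ := exists_isLeafAt_of_twinRep_ne hrep
  refine blueLine_eq_of_isLeafAt hT hux hx ?_ ?_ ?_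
  · rintro rfl
    exact h rfl
  · rintro rfl
    exact h (twinRep_twinRep u).symm
  · rintro rfl
    exact hu hrep hux

lemma blueLine_twinRep (hT : T.IsTree) (h : twinRep T u ≠ twinRep T v)
    (hu : twinRep T u ≠ u → ¬ IsLeafAt T u v) (hv : twinRep T v ≠ v → ¬ IsLeafAt T v u) :
    blueLine T u v = blueLine T (twinRep T u) (twinRep T v) := by
  rw [blueLine_twinRep_left hT h hu, blueLine_comm,
    blueLine_twinRep_left hT (by rw [twinRep_twinRep]; exact h.symm) ?_, blueLine_comm]
  intro hvrep hvu
  by_cases hurep : twinRep T u = u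
  · exact hv hvrep (hurep ▸ hvu)
  · obtain ⟨x, hux, hx⟩ := exists_isLeafAt_of_twinRep_ne hurep
    obtain rfl := hx.2 v hvu.1.symm
    exact hu hurep hux

variable [Fintype V]

open Classical in
/-- The leaves of `T`. -/
noncomputable def leaves (T : SimpleGraph V) : Finset V :=
  {l | IsLeaf T l}

open Classical in
/-- The leaves of `T` attached to `x`. -/
noncomputable def leavesAt (T : SimpleGraph V) (x : V) : Finset V :=
  {l | IsLeafAt T l x}

open Classical in
/-- The vertices chosen to represent their twin classes. -/
noncomputable def twinReps (T : SimpleGraph V) : Finset V :=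
  {v | twinRep T v = v}

open Classical in
/-- The vertices with at least two leaves attached; they correspond to the twin classes with more
than one element. -/
noncomputable def twinStems (T : SimpleGraph V) : Finset V :=
  {x | 1 < #(leavesAt T x)}

@[simp] lemma mem_leaves : l ∈ leaves T ↔ IsLeaf T l := by simp [leaves]

@[simp] lemma mem_leavesAt : l ∈ leavesAt T x ↔ IsLeafAt T l x := by simp [leavesAt]

@[simp] lemma mem_twinReps : v ∈ twinReps T ↔ twinRep T v = v := by simp [twinReps]

lemma leavesAt_subset_leaves (x : V) : leavesAt T x ⊆ leaves T := fun _ hl =>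
  mem_leaves.2 ⟨x, mem_leavesAt.1 hl⟩

lemma mem_twinStems : x ∈ twinStems T ↔ 1 < #(leavesAt T x) := by simp [twinStems]

lemma mem_twinStems_iff_exists :
    x ∈ twinStems T ↔ ∃ u v, IsLeafAt T u x ∧ IsLeafAt T v x ∧ u ≠ v := by
  simp [mem_twinStems, one_lt_card]

lemma exists_isLeafAt_mem_twinStems (h : twinRep T l ≠ l) : ∃ x ∈ twinStems T, IsLeafAt T l x := by
  obtain ⟨x, hl, hrep⟩ := exists_isLeafAt_of_twinRep_ne h
  exact ⟨x, mem_twinStems_iff_exists.2 ⟨_, _, hrep, hl, h⟩, hl⟩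

lemma card_leavesAt_diff_twinReps [DecidableEq V] (h : (leavesAt T x).Nonempty) :
    #(leavesAt T x \ twinReps T) + 1 = #(leavesAt T x) := by
  obtain ⟨l, hl⟩ := h
  have : leavesAt T x ∩ twinReps T = {twinRep T l} := by
    ext v
    simp only [mem_inter, mem_leavesAt, mem_twinReps, mem_singleton] at hl ⊢
    constructor
    · rintro ⟨hv, hrep⟩
      rw [← hrep, twinRep_eq_twinRep_iff]
      exact .inr ⟨x, hv, hl⟩
    · rintro rfl
      refine ⟨?_, twinRep_twinRep l⟩
      rcases isTwin_twinRep (T := T) l with h | ⟨y, hrep, hy⟩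
      · rwa [h]
      · rwa [hl.eq hy]
  rw [← card_sdiff_add_card_inter (leavesAt T x) (twinReps T), this, card_singleton]

lemma disjoint_leavesAt (hxy : x ≠ y) : Disjoint (leavesAt T x) (leavesAt T y) :=
  disjoint_left.2 fun _ hx hy => hxy ((mem_leavesAt.1 hx).eq (mem_leavesAt.1 hy))

lemma card_biUnion_leavesAt [DecidableEq V] (s : Finset V) :
    #(s.biUnion (leavesAt T)) = ∑ x ∈ s, #(leavesAt T x) :=
  card_biUnion fun _ _ _ _ => disjoint_leavesAt

lemma card_compl_twinReps_add_card_twinStems [DecidableEq V] :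
    #(twinReps T)ᶜ + #(twinStems T) = ∑ x ∈ twinStems T, #(leavesAt T x) := by
  have hcompl : (twinReps T)ᶜ = (twinStems T).biUnion fun x => leavesAt T x \ twinReps T := by
    ext l
    simp only [mem_compl, mem_twinReps, mem_biUnion, mem_sdiff, mem_leavesAt]
    constructor
    · intro hl
      obtain ⟨x, hx, hlx⟩ := exists_isLeafAt_mem_twinStems hl
      exact ⟨x, hx, hlx, hl⟩
    · rintro ⟨x, -, -, hl⟩
      exact hl
  rw [hcompl, card_biUnion, card_eq_sum_ones, ← sum_add_distrib]
  · exact sum_congr rfl fun x hx =>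
      card_leavesAt_diff_twinReps (card_pos.1 (zero_lt_one.trans (mem_twinStems.1 hx)))
  · intro x _ y _ hxy
    exact (disjoint_leavesAt hxy).mono sdiff_subset sdiff_subset

lemma card_compl_twinReps_add_card_twinStems_le [DecidableEq V] :
    #(twinReps T)ᶜ + #(twinStems T) ≤ #(leaves T) := by
  rw [card_compl_twinReps_add_card_twinStems, ← card_biUnion_leavesAt]
  exact card_le_card (biUnion_subset.2 fun x _ => leavesAt_subset_leaves x)

/-- The blue lines `{l, x}`, where `l` is a leaf attached to `x` that does not represent its twin
class. -/
def pendantLines (T : SimpleGraph V) : Set (Set V) :=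
  (fun l => insert l (T.neighborSet l)) '' ((twinReps T : Set V)ᶜ)

/-- The blue lines generated by two twins, which are the complements of the vertices with at least
two leaves attached. -/
def twinLines (T : SimpleGraph V) : Set (Set V) :=
  (fun x => {x}ᶜ) '' (twinStems T : Set V)

variable {L : Set V}

lemma mem_pendantLines (hT : T.IsTree) :
    L ∈ pendantLines T ↔ ∃ l x, twinRep T l ≠ l ∧ IsLeafAt T l x ∧ L = blueLine T l x := by
  simp only [pendantLines, Set.mem_image, Set.mem_compl_iff, mem_coe, mem_twinReps]
  constructor
  · rintro ⟨l, hl, rfl⟩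
    obtain ⟨x, hlx, -⟩ := exists_isLeafAt_of_twinRep_ne hl
    exact ⟨l, x, hl, hlx, by rw [blueLine_of_adj hT hlx.1, hlx.neighborSet_eq]⟩
  · rintro ⟨l, x, hl, hlx, rfl⟩
    exact ⟨l, hl, by rw [blueLine_of_adj hT hlx.1, hlx.neighborSet_eq]⟩

lemma mem_twinLines (hT : T.IsTree) :
    L ∈ twinLines T ↔ ∃ u v, u ≠ v ∧ twinRep T u = twinRep T v ∧ L = blueLine T u v := by
  simp only [twinLines, Set.mem_image, mem_coe, mem_twinStems_iff_exists, twinRep_eq_twinRep_iff]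
  constructor
  · rintro ⟨x, ⟨u, v, hu, hv, huv⟩, rfl⟩
    exact ⟨u, v, huv, .inr ⟨x, hu, hv⟩, (blueLine_of_isLeafAt hT hu hv huv).symm⟩
  · rintro ⟨u, v, huv, huv' | ⟨x, hu, hv⟩, rfl⟩
    · exact absurd huv' huv
    · exact ⟨x, ⟨u, v, hu, hv, huv⟩, (blueLine_of_isLeafAt hT hu hv huv).symm⟩

lemma pairValues_blueLine_univ (hT : T.IsTree) : pairValues (blueLine T) univ =
    pairValues (blueLine T) (twinReps T) ∪ pendantLines T ∪ twinLines T := by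
  ext L
  simp only [Set.mem_union, mem_pendantLines hT, mem_twinLines hT]
  constructor
  · rintro ⟨u, -, v, -, huv, rfl⟩
    by_cases hrep : twinRep T u = twinRep T v
    · exact .inr ⟨u, v, huv, hrep, rfl⟩
    by_cases hu : twinRep T u ≠ u ∧ IsLeafAt T u v
    · exact .inl (.inr ⟨u, v, hu.1, hu.2, rfl⟩)
    by_cases hv : twinRep T v ≠ v ∧ IsLeafAt T v u
    · exact .inl (.inr ⟨v, u, hv.1, hv.2, blueLine_comm u v⟩)
    rw [blueLine_twinRep hT hrep (not_and.1 hu) (not_and.1 hv)]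
    exact .inl (.inl (mem_pairValues (mem_twinReps.2 (twinRep_twinRep u))
      (mem_twinReps.2 (twinRep_twinRep v)) hrep))
  · rintro ((⟨u, -, v, -, huv, rfl⟩ | ⟨l, x, -, hlx, rfl⟩) | ⟨u, v, huv, -, rfl⟩)
    · exact mem_pairValues (mem_univ u) (mem_univ v) huv
    · exact mem_pairValues (mem_univ l) (mem_univ x) hlx.1.ne
    · exact mem_pairValues (mem_univ u) (mem_univ v) huv

lemma disjoint_pairValues_twinReps_pendantLines (hT : T.IsTree) :
    Disjoint (pairValues (blueLine T) (twinReps T)) (pendantLines T) := by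
  refine Set.disjoint_left.2 fun L hL hL' => ?_
  obtain ⟨u, hu, v, hv, huv, rfl⟩ := hL
  obtain ⟨l, x, hl, hlx, h⟩ := (mem_pendantLines hT).1 hL'
  rw [blueLine_of_adj hT hlx.1] at h
  have hul : u ∈ ({l, x} : Set V) := h ▸ left_mem_blueLine u v
  have hvl : v ∈ ({l, x} : Set V) := h ▸ right_mem_blueLine u v
  grind [mem_twinReps]

lemma disjoint_union_pendantLines_twinLines (hT : T.IsTree) :
    Disjoint (pairValues (blueLine T) (twinReps T) ∪ pendantLines T) (twinLines T) := by
  refine Set.disjoint_left.2 fun L hL hL' => ?_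
  obtain ⟨a, b, hab, hrep, rfl⟩ := (mem_twinLines hT).1 hL'
  obtain ⟨u, v, huv, h⟩ :
      ∃ u v, twinRep T u ≠ twinRep T v ∧ blueLine T a b = blueLine T u v := by
    rcases hL with ⟨u, hu, v, hv, huv, h⟩ | hL
    · rw [mem_twinReps] at hu hv
      exact ⟨u, v, by rwa [hu, hv], h⟩
    · obtain ⟨l, x, hl, hlx, h⟩ := (mem_pendantLines hT).1 hL
      refine ⟨l, x, fun hlx' => ?_, h⟩
      rcases twinRep_eq_twinRep_iff.1 hlx' with rfl | ⟨y, -, hxy⟩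
      · exact hlx.1.ne rfl
      · exact not_isLeaf_of_twinRep_ne hl hlx ⟨y, hxy⟩
  have hpair := twinRep_pair_eq_of_blueLine_eq hT hab (mt (congrArg _) huv) h
  grind [Sym2.eq_iff]

lemma ncard_pairValues_blueLine_twinReps (hT : T.IsTree) :
    (pairValues (blueLine T) (twinReps T)).ncard = (#(twinReps T)).choose 2 := by
  refine ncard_pairValues blueLine_comm fun u hu v hv a ha b hb huv hab h => ?_
  rw [mem_twinReps] at hu hv ha hb
  rw [← hu, ← hv, ← ha, ← hb]
  exact twinRep_pair_eq_of_blueLine_eq hT huv hab h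

lemma ncard_pendantLines [DecidableEq V] : (pendantLines T).ncard = #(twinReps T)ᶜ := by
  rw [← Set.ncard_coe_finset, coe_compl]
  refine Set.InjOn.ncard_image fun l hl m hm h => ?_
  simp only [Set.mem_compl_iff, mem_coe, mem_twinReps] at hl hm h
  obtain ⟨x, hlx, -⟩ := exists_isLeafAt_of_twinRep_ne hl
  obtain ⟨y, hmy, -⟩ := exists_isLeafAt_of_twinRep_ne hm
  rw [hlx.neighborSet_eq, hmy.neighborSet_eq] at h
  rcases (h ▸ Set.mem_insert l {x} : l ∈ ({m, y} : Set V)) with hlm | rfl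
  · exact hlm
  · exact absurd ⟨x, hlx⟩ (not_isLeaf_of_twinRep_ne hm hmy)

lemma ncard_twinLines : (twinLines T).ncard = #(twinStems T) := by
  rw [← Set.ncard_coe_finset]
  exact Set.ncard_image_of_injective _ fun x y h => by simpa using h

lemma ncard_pairValues_blueLine [DecidableEq V] (hT : T.IsTree) :
    (pairValues (blueLine T) univ).ncard =
      (#(twinReps T)).choose 2 + #(twinReps T)ᶜ + #(twinStems T) := by
  rw [pairValues_blueLine_univ hT, Set.ncard_union_eq (disjoint_union_pendantLines_twinLines hT),
    Set.ncard_union_eq (disjoint_pairValues_twinReps_pendantLines hT),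
    ncard_pairValues_blueLine_twinReps hT, ncard_pendantLines, ncard_twinLines]

end BlueCount

section RedLeafLines

variable {V : Type*} {T : SimpleGraph V} {p u v : V}

lemma eq_or_eq_of_isCollinear_of_isLeaf (hT : T.IsTree) (hu : IsLeaf T u) (hv : IsLeaf T v)
    (hp : IsLeaf T p) (huv : u ≠ v) (h : IsCollinear T u v p) : p = u ∨ p = v := by
  rcases h with h | h | h
  · exact hp.eq_or_eq_of_isBetween hT h
  · exact .inl ((hu.eq_or_eq_of_isBetween hT h).resolve_right huv).symm
  · exact .inr ((hv.eq_or_eq_of_isBetween hT h).resolve_left huv.symm).symm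

variable [Fintype V]

lemma ncard_pairValues_redLine_leaves (hT : T.IsTree) :
    (pairValues (redLine T) (leaves T)).ncard = (#(leaves T)).choose 2 := by
  refine ncard_pairValues redLine_comm fun u hu v hv a ha b hb huv hab h => ?_
  rw [mem_leaves] at hu hv ha hb
  have ha : a ∈ redLine T u v := h ▸ isCollinear_left a b
  have hb : b ∈ redLine T u v := h ▸ isCollinear_right a b
  have := eq_or_eq_of_isCollinear_of_isLeaf hT hu hv ‹_› huv ha
  have := eq_or_eq_of_isCollinear_of_isLeaf hT hu hv ‹_› huv hb
  grind [Sym2.eq_iff]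

lemma univ_notMem_pairValues_redLine_leaves (hT : T.IsTree) (h3 : 3 ≤ #(leaves T)) :
    Set.univ ∉ pairValues (redLine T) (leaves T) := by
  rintro ⟨u, hu, v, hv, huv, h⟩
  obtain ⟨p, hp, hpu, hpv⟩ : ∃ p ∈ leaves T, p ≠ u ∧ p ≠ v := by
    classical
    obtain ⟨p, hp, hpuv⟩ := exists_mem_notMem_of_card_lt_card (card_le_two.trans_lt h3)
    exact ⟨p, hp, by simpa using hpuv⟩
  have hcol : p ∈ redLine T u v := h ▸ Set.mem_univ p
  rw [mem_leaves] at hu hv hp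
  exact (eq_or_eq_of_isCollinear_of_isLeaf hT hu hv hp huv hcol).elim hpu hpv

lemma choose_card_leaves_add_one_le (hT : T.IsTree) (h3 : 3 ≤ #(leaves T)) :
    (#(leaves T)).choose 2 + 1 ≤ (pairValues (redLine T) univ).ncard := by
  rw [← ncard_pairValues_redLine_leaves hT,
    ← Set.ncard_insert_of_notMem (univ_notMem_pairValues_redLine_leaves hT h3) (Set.toFinite _)]
  refine Set.ncard_le_ncard ?_ (Set.toFinite _)
  obtain ⟨l, hl⟩ := card_pos.1 (by lia : 0 < #(leaves T))
  obtain ⟨x, hlx, -⟩ := mem_leaves.1 hl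
  rw [Set.insert_subset_iff, ← redLine_of_adj hT hlx]
  refine ⟨mem_pairValues (mem_univ l) (mem_univ x) hlx.ne, ?_⟩
  rintro _ ⟨u, -, v, -, huv, rfl⟩
  exact mem_pairValues (mem_univ u) (mem_univ v) huv

end RedLeafLines

section Paths

variable {V W : Type*} {T : SimpleGraph V} {G : SimpleGraph W} {l x : V} {n : ℕ}

lemma isLeafAt_map_iff (φ : T ≃g G) : IsLeafAt G (φ l) (φ x) ↔ IsLeafAt T l x := by
  simp only [IsLeafAt, φ.map_adj_iff, φ.surjective.forall, φ.injective.eq_iff]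

lemma isLeaf_map_iff (φ : T ≃g G) : IsLeaf G (φ l) ↔ IsLeaf T l := by
  simp only [IsLeaf, φ.surjective.exists, isLeafAt_map_iff]

lemma val_eq_of_isLeaf_pathGraph {i : Fin n} (h : IsLeaf (pathGraph n) i) :
    i.val = 0 ∨ i.val = n - 1 := by
  obtain ⟨x, -, hx⟩ := h
  by_contra! hi
  have hpred := hx ⟨i.val - 1, by lia⟩ (pathGraph_adj.2 (.inr (by grind)))
  have hsucc := hx ⟨i.val + 1, by lia⟩ (pathGraph_adj.2 (.inl rfl))
  grind

variable [Fintype V]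

lemma card_leaves_le_two_of_isPathOn (h : T.IsPathOn n) : #(leaves T) ≤ 2 := by
  obtain ⟨φ⟩ := h
  have hval : Set.MapsTo (fun l => (φ l).val) (leaves T) ({0, n - 1} : Finset ℕ) := fun l hl => by
    simpa using val_eq_of_isLeaf_pathGraph ((isLeaf_map_iff φ).2 (mem_leaves.1 hl))
  exact (card_le_card_of_injOn _ hval (Fin.val_injective.comp φ.injective).injOn).trans card_le_two

variable [Nontrivial V]

lemma exists_forall_isBetween (hT : T.IsTree) (h : #(leaves T) ≤ 2) :
    ∃ a b, ∀ v, IsBetween T a v b := by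
  classical
  obtain ⟨a, b, ha, hb, hab⟩ := exists_ne_isLeaf hT
  have hleaves : {a, b} = leaves T := eq_of_subset_of_card_le
    (by simp [insert_subset_iff, ha, hb]) (by rwa [card_pair hab])
  refine ⟨a, b, fun v => ?_⟩
  obtain rfl | hva := eq_or_ne v a
  · exact isBetween_left v b
  obtain ⟨l, hl, hla, hbetween⟩ := exists_isLeaf_isBetween hT hva
  rw [← mem_leaves, ← hleaves] at hl
  grind

lemma isPathOn_of_card_leaves_le_two (hT : T.IsTree) (h : #(leaves T) ≤ 2) :
    T.IsPathOn (Fintype.card V) := by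
  obtain ⟨a, b, hab⟩ := exists_forall_isBetween hT h
  have hdist : ∀ v, T.dist a v < Fintype.card V := fun v => by
    obtain ⟨P, hP, hlen⟩ := hT.connected.exists_path_of_dist a v
    exact hlen ▸ hP.length_lt
  let f : V → Fin (Fintype.card V) := fun v => ⟨T.dist a v, hdist v⟩
  have hf : Function.Bijective f := by
    refine (Fintype.bijective_iff_injective_and_card f).2 ⟨fun u v huv => ?_, by simp⟩
    exact eq_of_isBetween_of_dist_eq hT (hab u) (hab v) (congrArg Fin.val huv)
  refine ⟨⟨Equiv.ofBijective f hf, fun {u v} => ?_⟩⟩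
  have := dist_add_eq_or_dist_add_eq hT (hab u) (hab v)
  rw [pathGraph_adj, ← dist_eq_one_iff_adj]
  simp only [Equiv.ofBijective_apply, f]
  lia

lemma isPathOn_iff_card_leaves_le_two (hT : T.IsTree) (hn : Fintype.card V = n) :
    T.IsPathOn n ↔ #(leaves T) ≤ 2 :=
  ⟨card_leaves_le_two_of_isPathOn, fun h => hn ▸ isPathOn_of_card_leaves_le_two hT h⟩

lemma numLines_of_isPathOn (hT : T.IsTree) (w : Sym2 V → ℝ) (h : T.IsPathOn n) :
    (T.derivedSystem w).numLines = (Fintype.card V).choose 2 + 1 := by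
  obtain ⟨a, b, hab⟩ := exists_forall_isBetween hT (card_leaves_le_two_of_isPathOn h)
  have hred : ∀ u v, redLine T u v = Set.univ := fun u v =>
    Set.eq_univ_of_forall fun p => isCollinear_of_isBetween hT (hab u) (hab v) (hab p)
  have hblue : ∀ u v, blueLine T u v = {u, v} := by simp [blueLine, hred]
  have hncard_red : (pairValues (redLine T) univ).ncard = 1 := by
    obtain ⟨u, v, huv⟩ := exists_pair_ne V
    refine Set.ncard_eq_one.2 ⟨Set.univ, Set.eq_singleton_iff_unique_mem.2 ⟨?_, ?_⟩⟩
    · exact hred u v ▸ mem_pairValues (mem_univ u) (mem_univ v) huv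
    · rintro _ ⟨u, -, v, -, -, rfl⟩
      exact hred u v
  have hncard_blue : (pairValues (blueLine T) univ).ncard = (Fintype.card V).choose 2 := by
    refine ncard_pairValues blueLine_comm fun u _ v _ a _ b _ _ _ h => ?_
    rw [hblue, hblue] at h
    exact Sym2.eq_iff.2 (Set.pair_eq_pair_iff.1 h)
  rw [numLines_eq hT, hncard_red, hncard_blue, add_comm]

end Paths

section Brooms

variable {V W : Type*} {T : SimpleGraph V} {G : SimpleGraph W} {u v x z : V} {p q s : ℕ}

/-- `T` has the shape of a broom `S(p, q)` with `q ≥ 3` whose leaves are attached to `x`, and whose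
path leads from `x` to `z`: the leaves of `T` are `z`, which is not attached to `x`, and leaves
attached to `x`. -/
structure IsBroomAt (T : SimpleGraph V) (x z : V) : Prop where
  isLeaf : IsLeaf T z
  not_isLeafAt : ¬ IsLeafAt T z x
  isLeafAt : ∀ l, IsLeaf T l → l ≠ z → IsLeafAt T l x

lemma isBroomAt_of_map (φ : T ≃g G) (h : IsBroomAt G (φ x) (φ z)) : IsBroomAt T x z where
  isLeaf := (isLeaf_map_iff φ).1 h.isLeaf
  not_isLeafAt := mt (isLeafAt_map_iff φ).2 h.not_isLeafAt
  isLeafAt _ hl hlz :=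
    (isLeafAt_map_iff φ).1 (h.isLeafAt _ ((isLeaf_map_iff φ).2 hl) (φ.injective.ne hlz))

lemma IsBroomAt.isBetween [Finite V] (h : IsBroomAt T x z) (hT : T.IsTree)
    (hv : ¬ IsLeafAt T v x) : IsBetween T x v z := by
  obtain rfl | hvz := eq_or_ne v z
  · exact isBetween_right x v
  obtain ⟨l, hl, hlz, hbetween⟩ := exists_isLeaf_isBetween hT hvz
  have hlx := h.isLeafAt l hl hlz
  have hvl : v ≠ l := fun hvl => hv (hvl ▸ hlx)
  grind [IsBetween, SimpleGraph.dist_comm, hlx.dist_right hT hvl, hlx.dist_right hT hlz.symm]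

lemma IsBroomAt.ne [Finite V] (h : IsBroomAt T x z) (hT : T.IsTree) (hv : ¬ IsLeafAt T v x)
    (hvx : v ≠ x) : z ≠ x := by
  rintro rfl
  have := h.isBetween hT hv
  have := hT.connected.pos_dist_of_ne hvx
  grind [IsBetween]

lemma IsBroomAt.redLine_of_not_isLeafAt [Finite V] (h : IsBroomAt T x z) (hT : T.IsTree)
    (hu : ¬ IsLeafAt T u x) (hv : ¬ IsLeafAt T v x) : redLine T u v = Set.univ := by
  refine Set.eq_univ_of_forall fun p => ?_
  have hxu := h.isBetween hT hu
  have hxv := h.isBetween hT hv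
  by_cases hp : IsLeafAt T p x
  · have hup := hp.dist_left hT (u := u) (fun hup => hu (hup ▸ hp))
    have hvp := hp.dist_left hT (u := v) (fun hvp => hv (hvp ▸ hp))
    have := dist_add_eq_or_dist_add_eq hT hxu hxv
    change IsCollinear T u v p
    grind [IsCollinear, IsBetween, SimpleGraph.dist_comm]
  · exact isCollinear_of_isBetween hT hxu hxv (h.isBetween hT hp)

lemma IsBroomAt.redLine_of_isLeafAt [Finite V] (h : IsBroomAt T x z) (hT : T.IsTree)
    (hu : IsLeafAt T u x) (hv : ¬ IsLeafAt T v x) (hvx : v ≠ x) :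
    redLine T u v = {p | p = u ∨ ¬ IsLeafAt T p x} := by
  ext p
  change IsCollinear T u v p ↔ p = u ∨ ¬ IsLeafAt T p x
  have hvu := hu.dist_left hT (u := v) (fun hvu => hv (hvu ▸ hu))
  have hpos := hT.connected.pos_dist_of_ne hvx
  obtain rfl | hpu := eq_or_ne p u
  · simp [isCollinear_left]
  have hpu' := hu.dist_left hT hpu
  by_cases hp : IsLeafAt T p x
  · have hvp := hp.dist_left hT (u := v) (fun hvp => hv (hvp ▸ hp))
    have := dist_eq_one_of_adj hp.1
    grind [IsCollinear, IsBetween, SimpleGraph.dist_comm]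
  · have := dist_add_eq_or_dist_add_eq hT (h.isBetween hT hv) (h.isBetween hT hp)
    grind [IsCollinear, IsBetween, SimpleGraph.dist_comm]

variable [Fintype V]

lemma IsBroomAt.redLine_mem_of_isLeafAt (h : IsBroomAt T x z) (hT : T.IsTree)
    (hu : IsLeafAt T u x) (hv : ¬ IsLeafAt T v x) :
    redLine T u v ∈ insert Set.univ (pairValues (redLine T) (leaves T)) := by
  obtain rfl | hvx := eq_or_ne v x
  · exact .inl (redLine_of_adj hT hu.1)
  rw [h.redLine_of_isLeafAt hT hu hv hvx,
    ← h.redLine_of_isLeafAt hT hu h.not_isLeafAt (h.ne hT hv hvx)]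
  exact .inr (mem_pairValues (mem_leaves.2 ⟨x, hu⟩) (mem_leaves.2 h.isLeaf)
    fun huz => h.not_isLeafAt (huz ▸ hu))

lemma IsBroomAt.pairValues_redLine_subset (h : IsBroomAt T x z) (hT : T.IsTree) :
    pairValues (redLine T) univ ⊆ insert Set.univ (pairValues (redLine T) (leaves T)) := by
  rintro _ ⟨u, -, v, -, huv, rfl⟩
  by_cases hu : IsLeafAt T u x <;> by_cases hv : IsLeafAt T v x
  · exact .inr (mem_pairValues (mem_leaves.2 ⟨x, hu⟩) (mem_leaves.2 ⟨x, hv⟩) huv)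
  · exact h.redLine_mem_of_isLeafAt hT hu hv
  · exact redLine_comm u v ▸ h.redLine_mem_of_isLeafAt hT hv hu
  · exact .inl (h.redLine_of_not_isLeafAt hT hu hv)

lemma IsBroomAt.ncard_pairValues_redLine_le (h : IsBroomAt T x z) (hT : T.IsTree) :
    (pairValues (redLine T) univ).ncard ≤ (#(leaves T)).choose 2 + 1 := by
  rw [← ncard_pairValues_redLine_leaves hT]
  exact (Set.ncard_le_ncard (h.pairValues_redLine_subset hT) (Set.toFinite _)).trans
    (Set.ncard_insert_le _ _)

lemma IsBroomAt.card_leaves (h : IsBroomAt T x z) : #(leaves T) = #(leavesAt T x) + 1 := by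
  classical
  have hleaves : leaves T = insert z (leavesAt T x) := by
    ext l
    rw [mem_leaves, mem_insert, mem_leavesAt]
    constructor
    · exact fun hl => or_iff_not_imp_left.2 (h.isLeafAt l hl)
    · rintro (rfl | hl)
      exacts [h.isLeaf, ⟨x, hl⟩]
  rw [hleaves, card_insert_of_notMem (mt mem_leavesAt.1 h.not_isLeafAt)]

lemma IsBroomAt.twinStems_eq (h : IsBroomAt T x z) (hx : x ∈ twinStems T) :
    twinStems T = {x} := by
  refine eq_singleton_iff_unique_mem.2 ⟨hx, fun y hy => ?_⟩
  obtain ⟨u, v, hu, hv, huv⟩ := mem_twinStems_iff_exists.1 hy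
  rcases eq_or_ne u z with rfl | huz
  · exact hv.eq (h.isLeafAt v ⟨y, hv⟩ huv.symm)
  · exact hu.eq (h.isLeafAt u ⟨y, hu⟩ huz)

/-- The number of lines of a broom with `n` vertices that has `s + 1` leaves at one end: the first
two summands count the red lines, the last three the blue lines. -/
def broomLines (n s : ℕ) : ℕ :=
  (s + 2).choose 2 + 1 + ((n - s).choose 2 + s + 1)

lemma IsBroomAt.numLines_eq (h : IsBroomAt T x z) (hT : T.IsTree) (w : Sym2 V → ℝ)
    (hs : #(leavesAt T x) = s + 1) (hs1 : 1 ≤ s) :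
    (T.derivedSystem w).numLines = broomLines (Fintype.card V) s := by
  classical
  have hstems := h.twinStems_eq (mem_twinStems.2 (by lia))
  have hcompl := card_compl_twinReps_add_card_twinStems (T := T)
  rw [hstems, sum_singleton, card_singleton, hs] at hcompl
  have hleaves := h.card_leaves
  have hreps := card_add_card_compl (twinReps T)
  have hred := le_antisymm (h.ncard_pairValues_redLine_le hT)
    (choose_card_leaves_add_one_le hT (by lia))
  rw [TreeLines.numLines_eq hT, hred, ncard_pairValues_blueLine hT, hstems, card_singleton,
    broomLines, show #(leaves T) = s + 2 by lia, show #(twinReps T)ᶜ = s by lia,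
    show #(twinReps T) = Fintype.card V - s by lia]

end Brooms

section BroomGraph

variable {V : Type*} {T : SimpleGraph V} {l u v x z : V} {p q : ℕ}

@[simp] lemma not_broom_adj_inl_inl (i j : Fin p) : ¬ (broom p q).Adj (.inl i) (.inl j) := by
  simp [broom]

@[simp] lemma broom_adj_inl_inr (i : Fin p) (j : Fin q) :
    (broom p q).Adj (.inl i) (.inr j) ↔ j.val = 0 := by
  simp [broom]

@[simp] lemma broom_adj_inr_inl (i : Fin p) (j : Fin q) :
    (broom p q).Adj (.inr j) (.inl i) ↔ j.val = 0 := by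
  simp [broom]

@[simp] lemma broom_adj_inr_inr (i j : Fin q) :
    (broom p q).Adj (.inr i) (.inr j) ↔ i.val + 1 = j.val ∨ j.val + 1 = i.val := by
  simp only [broom, fromRel_adj, ne_eq, Sum.inr.injEq, Fin.ext_iff]
  lia

lemma IsLeafAt.adj_iff (hl : IsLeafAt T l x) : T.Adj l v ↔ v = x :=
  ⟨hl.2 v, fun h => h ▸ hl.1⟩

lemma not_isLeafAt_self (x : V) : ¬ IsLeafAt T x x := fun h => h.1.ne rfl

lemma isLeafAt_broom_inl (i : Fin p) (hq : 0 < q) :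
    IsLeafAt (broom p q) (.inl i) (.inr ⟨0, hq⟩) := by
  simp [IsLeafAt, Fin.ext_iff]

lemma isLeafAt_broom_last (hq : 2 ≤ q) :
    IsLeafAt (broom p q) (.inr ⟨q - 1, by lia⟩) (.inr ⟨q - 2, by lia⟩) := by
  simp only [IsLeafAt, broom_adj_inr_inr, broom_adj_inr_inl, Sum.forall, Sum.inr.injEq,
    Fin.ext_iff]
  lia

lemma val_eq_of_isLeaf_broom (hp : 1 ≤ p) {j : Fin q} (h : IsLeaf (broom p q) (.inr j)) :
    j.val = q - 1 := by
  obtain ⟨x, -, hx⟩ := h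
  by_contra hj
  have hsucc := hx (.inr ⟨j.val + 1, by lia⟩) (by simp)
  by_cases hj0 : j.val = 0
  · have hleaf := hx (.inl ⟨0, hp⟩) (by simpa)
    exact absurd (hsucc.trans hleaf.symm) Sum.inr_ne_inl
  · have hpred := hx (.inr ⟨j.val - 1, by lia⟩) (by rw [broom_adj_inr_inr]; lia)
    have := congrArg Fin.val (Sum.inr_injective (hsucc.trans hpred.symm))
    lia

lemma isBroomAt_broom (hp : 1 ≤ p) (hq : 3 ≤ q) :
    IsBroomAt (broom p q) (.inr ⟨0, by lia⟩) (.inr ⟨q - 1, by lia⟩) where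
  isLeaf := ⟨_, isLeafAt_broom_last (by lia)⟩
  not_isLeafAt h := by
    have := h.eq (isLeafAt_broom_last (by lia))
    grind
  isLeafAt := by
    rintro (i | j) hl hlz
    · exact isLeafAt_broom_inl i _
    · exact absurd (congrArg Sum.inr (Fin.ext (val_eq_of_isLeaf_broom hp hl))) hlz

lemma isLeafAt_broom_iff (hp : 1 ≤ p) (hq : 3 ≤ q) {l : Fin p ⊕ Fin q} :
    IsLeafAt (broom p q) l (.inr ⟨0, by lia⟩) ↔ l ∈ Set.range Sum.inl := by
  constructor
  · intro hl
    rcases l with i | j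
    · exact ⟨i, rfl⟩
    · have hj : j = ⟨q - 1, by lia⟩ := Fin.ext (val_eq_of_isLeaf_broom hp ⟨_, hl⟩)
      exact absurd (hj ▸ hl) (isBroomAt_broom hp hq).not_isLeafAt
  · rintro ⟨i, rfl⟩
    exact isLeafAt_broom_inl i _

lemma IsBroomAt.adj_iff [Finite V] (h : IsBroomAt T x z) (hT : T.IsTree) (hu : ¬ IsLeafAt T u x)
    (hv : ¬ IsLeafAt T v x) :
    T.Adj u v ↔ T.dist x u + 1 = T.dist x v ∨ T.dist x v + 1 = T.dist x u := by
  have := dist_add_eq_or_dist_add_eq hT (h.isBetween hT hu) (h.isBetween hT hv)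
  rw [← dist_eq_one_iff_adj]
  lia

variable [Fintype V]

lemma exists_isBroomAt_of_iso_broom (hp : 1 ≤ p) (hq : 3 ≤ q) (φ : T ≃g broom p q) :
    ∃ x z, IsBroomAt T x z ∧ #(leavesAt T x) = p := by
  classical
  obtain ⟨x, hx⟩ := φ.surjective (.inr ⟨0, by lia⟩)
  obtain ⟨z, hz⟩ := φ.surjective (.inr ⟨q - 1, by lia⟩)
  refine ⟨x, z, isBroomAt_of_map φ (hx ▸ hz ▸ isBroomAt_broom hp hq), ?_⟩
  have himage : (leavesAt T x).image φ = univ.image Sum.inl := by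
    ext l
    obtain ⟨l, rfl⟩ := φ.surjective l
    simp only [mem_image, mem_leavesAt, φ.injective.eq_iff, exists_eq_right, mem_univ, true_and,
      ← isLeafAt_map_iff φ, hx, isLeafAt_broom_iff hp hq, Set.mem_range]
  rw [← card_image_of_injective _ φ.injective, himage,
    card_image_of_injective _ Sum.inl_injective, card_univ, Fintype.card_fin]

lemma dist_lt_card_sub_card_leavesAt (hT : T.IsTree) (hv : ¬ IsLeafAt T v x) :
    T.dist x v < Fintype.card V - #(leavesAt T x) := by
  classical
  obtain ⟨P, hP, hlen⟩ := hT.connected.exists_path_of_dist x v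
  have hsupport : P.support.toFinset ⊆ (leavesAt T x)ᶜ := by
    intro y hy
    rw [List.mem_toFinset, mem_support_iff_isBetween hT hP] at hy
    rw [mem_compl, mem_leavesAt]
    intro hyx
    rcases IsLeaf.eq_or_eq_of_isBetween ⟨x, hyx⟩ hT hy with rfl | rfl
    · exact not_isLeafAt_self _ hyx
    · exact hv hyx
  have := card_le_card hsupport
  rwa [List.toFinset_card_of_nodup hP.support_nodup, Walk.length_support, hlen, card_compl] at this

lemma IsBroomAt.nonempty_iso_broom (h : IsBroomAt T x z) (hT : T.IsTree) :
    Nonempty (T ≃g broom #(leavesAt T x) (Fintype.card V - #(leavesAt T x))) := by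
  classical
  set p := #(leavesAt T x) with hp
  have hcard : Fintype.card {v // IsLeafAt T v x} = p := by
    simp only [hp, leavesAt, Fintype.card_subtype]
  have hcard_compl : Fintype.card {v // ¬ IsLeafAt T v x} = Fintype.card V - p := by
    rw [Fintype.card_subtype_compl, hcard]
  let depth : {v // ¬ IsLeafAt T v x} → Fin (Fintype.card V - p) := fun v =>
    ⟨T.dist x v, dist_lt_card_sub_card_leavesAt hT v.2⟩
  have hdepth : Function.Bijective depth := by
    refine (Fintype.bijective_iff_injective_and_card depth).2
      ⟨fun u v huv => Subtype.ext ?_, by rw [hcard_compl, Fintype.card_fin]⟩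
    exact eq_of_isBetween_of_dist_eq hT (h.isBetween hT u.2) (h.isBetween hT v.2)
      (congrArg Fin.val huv)
  let split := Equiv.sumCompl fun v => IsLeafAt T v x
  let e := (Fintype.equivFinOfCardEq hcard).sumCongr (Equiv.ofBijective depth hdepth)
  have hadj : ∀ {u v}, IsLeafAt T u x → (T.dist x v = 0 ↔ T.Adj u v) := fun hu => by
    rw [hT.connected.dist_eq_zero_iff, hu.adj_iff, eq_comm]
  have he : ∀ a b, (broom p _).Adj (e a) (e b) ↔ T.Adj (split a) (split b) := by
    rintro (⟨u, hu⟩ | ⟨u, hu⟩) (⟨v, hv⟩ | ⟨v, hv⟩)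
    · refine iff_of_false (not_broom_adj_inl_inl _ _) fun huv => not_isLeafAt_self (T := T) x ?_
      exact hu.adj_iff.1 huv ▸ hv
    · exact (broom_adj_inl_inr _ _).trans (hadj hu)
    · exact (broom_adj_inr_inl _ _).trans ((hadj hv).trans (T.adj_comm _ _))
    · exact (broom_adj_inr_inr _ _).trans (h.adj_iff hT hu hv).symm
  refine ⟨⟨split.symm.trans e, fun {u v} => ?_⟩⟩
  simpa using he (split.symm u) (split.symm v)

end BroomGraph

section NonPaths

variable {V : Type*} {T : SimpleGraph V} [Fintype V] {x z : V}

lemma choose_card_leaves_add_le_numLines [DecidableEq V] (hT : T.IsTree) (w : Sym2 V → ℝ)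
    (h3 : 3 ≤ #(leaves T)) :
    (#(leaves T)).choose 2 + 1 +
      ((Fintype.card V - #(twinReps T)ᶜ).choose 2 + #(twinReps T)ᶜ + #(twinStems T)) ≤
      (T.derivedSystem w).numLines := by
  have hreps := card_compl_add_card (twinReps T)
  rw [numLines_eq hT, ncard_pairValues_blueLine hT,
    show Fintype.card V - #(twinReps T)ᶜ = #(twinReps T) by lia]
  gcongr
  exact choose_card_leaves_add_one_le hT h3

lemma card_compl_twinReps_add_one [DecidableEq V] (h : twinStems T = {x}) :
    #(twinReps T)ᶜ + 1 = #(leavesAt T x) := by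
  simpa [h] using card_compl_twinReps_add_card_twinStems (T := T)

lemma choose_two_add_one_lt_numLines_of_twinStems_eq_empty (hT : T.IsTree) (w : Sym2 V → ℝ)
    (h3 : 3 ≤ #(leaves T)) (h : twinStems T = ∅) :
    (Fintype.card V).choose 2 + 1 < (T.derivedSystem w).numLines := by
  classical
  have hcompl : #(twinReps T)ᶜ = 0 := by
    simpa [h] using card_compl_twinReps_add_card_twinStems (T := T)
  have hlines := choose_card_leaves_add_le_numLines hT w h3
  have hchoose : Nat.choose 3 2 ≤ (#(leaves T)).choose 2 := Nat.choose_le_choose 2 h3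
  rw [hcompl, Nat.sub_zero] at hlines
  rw [show Nat.choose 3 2 = 3 from rfl] at hchoose
  lia

lemma card_le_card_leaves_add_one [Nontrivial V] (hT : T.IsTree) (h : leaves T ⊆ leavesAt T x) :
    Fintype.card V ≤ #(leaves T) + 1 := by
  classical
  have hleaf : ∀ {l}, IsLeaf T l → IsLeafAt T l x := fun hl =>
    mem_leavesAt.1 (h (mem_leaves.2 hl))
  obtain ⟨a, -, ha, -⟩ := exists_ne_isLeaf hT
  have huniv : univ ⊆ insert x (leaves T) := by
    intro v _
    rw [mem_insert, mem_leaves]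
    obtain rfl | hva := eq_or_ne v a
    · exact .inr ha
    obtain ⟨l, hl, hla, hbetween⟩ := exists_isLeaf_isBetween hT hva
    obtain rfl | hvl := eq_or_ne v l
    · exact .inr hl
    refine .inl (hT.connected.dist_eq_zero_iff.1 ?_)
    have := (hleaf ha).dist_left hT hla
    have := (hleaf hl).dist_right hT hvl
    have := (hleaf ha).dist_right hT hva
    have := dist_eq_one_of_adj (hleaf hl).1
    grind [IsBetween, SimpleGraph.dist_comm]
  exact (card_le_card huniv).trans (card_insert_le _ _)

lemma choose_two_add_one_lt_numLines_of_leaves_subset [Nontrivial V] (hT : T.IsTree)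
    (w : Sym2 V → ℝ) (h3 : 3 ≤ #(leaves T)) (hx : twinStems T = {x})
    (h : leaves T ⊆ leavesAt T x) :
    (Fintype.card V).choose 2 + 1 < (T.derivedSystem w).numLines := by
  classical
  have hlines := choose_card_leaves_add_le_numLines hT w h3
  have hcompl := card_compl_twinReps_add_one hx
  rw [← h.antisymm (leavesAt_subset_leaves x)] at hcompl
  rw [hx, card_singleton] at hlines
  obtain hn | hn : Fintype.card V = #(leaves T) + 1 ∨ Fintype.card V = #(leaves T) := by
    have := card_le_card_leaves_add_one hT h
    have := card_le_univ (leaves T)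
    lia
  · rw [show Fintype.card V - #(twinReps T)ᶜ = 2 by lia, Nat.choose_self] at hlines
    rw [hn, Nat.choose_succ_succ' _ 1, Nat.choose_one_right]
    lia
  · rw [hn]
    lia

lemma card_compl_twinReps_add_two_le [DecidableEq V] (hne : (twinStems T).Nonempty)
    (h : ∀ x, twinStems T = {x} → ¬ leaves T ⊆ leavesAt T x) :
    #(twinReps T)ᶜ + 2 ≤ #(leaves T) := by
  obtain hk | hk : #(twinStems T) = 1 ∨ 2 ≤ #(twinStems T) := by
    have := card_pos.2 hne
    lia
  · obtain ⟨x, hx⟩ := card_eq_one.1 hk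
    have := card_compl_twinReps_add_one hx
    have := card_lt_card (ssubset_iff_subset_not_subset.2 ⟨leavesAt_subset_leaves x, h x hx⟩)
    lia
  · have := card_compl_twinReps_add_card_twinStems_le (T := T)
    lia

lemma broomLines_le_numLines [DecidableEq V] (hT : T.IsTree) (w : Sym2 V → ℝ)
    (h3 : 3 ≤ #(leaves T)) (hne : (twinStems T).Nonempty)
    (hle : #(twinReps T)ᶜ + 2 ≤ #(leaves T)) :
    broomLines (Fintype.card V) #(twinReps T)ᶜ ≤ (T.derivedSystem w).numLines := by
  refine le_trans ?_ (choose_card_leaves_add_le_numLines hT w h3)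
  have := card_pos.2 hne
  unfold broomLines
  gcongr
  lia

lemma card_eq_of_numLines_eq_broomLines [DecidableEq V] (hT : T.IsTree) (w : Sym2 V → ℝ)
    (h3 : 3 ≤ #(leaves T)) (hne : (twinStems T).Nonempty)
    (hle : #(twinReps T)ᶜ + 2 ≤ #(leaves T))
    (h : (T.derivedSystem w).numLines = broomLines (Fintype.card V) #(twinReps T)ᶜ) :
    #(twinStems T) = 1 ∧ #(leaves T) = #(twinReps T)ᶜ + 2 := by
  have hlines := choose_card_leaves_add_le_numLines hT w h3
  rw [h, broomLines] at hlines
  have := card_pos.2 hne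
  have hmono := Nat.choose_le_choose 2 hle
  refine ⟨by lia, hle.antisymm' ?_⟩
  by_contra! hlt
  have hlt' := Nat.choose_le_choose 2 (Nat.succ_le_of_lt hlt)
  rw [Nat.choose_succ_succ' _ 1, Nat.choose_one_right] at hlt'
  lia

lemma exists_isBroomAt [DecidableEq V] (hk : #(twinStems T) = 1)
    (hl : #(leaves T) = #(twinReps T)ᶜ + 2) :
    ∃ x z, IsBroomAt T x z ∧ #(leavesAt T x) = #(twinReps T)ᶜ + 1 := by
  obtain ⟨x, hx⟩ := card_eq_one.1 hk
  have hcompl := card_compl_twinReps_add_one hx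
  obtain ⟨z, hz⟩ : ∃ z, leaves T \ leavesAt T x = {z} := by
    rw [← card_eq_one, card_sdiff_of_subset (leavesAt_subset_leaves x)]
    lia
  have hmem : ∀ l, IsLeaf T l ∧ ¬ IsLeafAt T l x ↔ l = z := by
    simpa [Finset.ext_iff] using hz
  refine ⟨x, z, ⟨((hmem z).2 rfl).1, ((hmem z).2 rfl).2, fun l hl hlz => ?_⟩, hcompl.symm⟩
  by_contra hlx
  exact hlz ((hmem l).1 ⟨hl, hlx⟩)

lemma lt_numLines_or_exists_broomLines_le [Nontrivial V] (hT : T.IsTree) (w : Sym2 V → ℝ)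
    (hpath : ¬ T.IsPathOn (Fintype.card V)) :
    (Fintype.card V).choose 2 + 1 < (T.derivedSystem w).numLines ∨
    ∃ s ≤ Fintype.card V, broomLines (Fintype.card V) s ≤ (T.derivedSystem w).numLines ∧
      ((T.derivedSystem w).numLines = broomLines (Fintype.card V) s →
        Nonempty (T ≃g broom (s + 1) (Fintype.card V - (s + 1)))) := by
  classical
  have h3 : 3 ≤ #(leaves T) := by
    rw [isPathOn_iff_card_leaves_le_two hT rfl] at hpath
    lia
  obtain hempty | hne := (twinStems T).eq_empty_or_nonempty
  · exact .inl (choose_two_add_one_lt_numLines_of_twinStems_eq_empty hT w h3 hempty)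
  by_cases hstar : ∃ x, twinStems T = {x} ∧ leaves T ⊆ leavesAt T x
  · obtain ⟨x, hx, hsub⟩ := hstar
    exact .inl (choose_two_add_one_lt_numLines_of_leaves_subset hT w h3 hx hsub)
  push Not at hstar
  have hle := card_compl_twinReps_add_two_le hne hstar
  refine .inr ⟨#(twinReps T)ᶜ, card_le_univ _, broomLines_le_numLines hT w h3 hne hle, fun h => ?_⟩
  obtain ⟨hk, hl⟩ := card_eq_of_numLines_eq_broomLines hT w h3 hne hle h
  obtain ⟨x, z, hbroom, hx⟩ := exists_isBroomAt hk hl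
  exact hx ▸ hbroom.nonempty_iso_broom hT

end NonPaths

section Arithmetic

variable {n s : ℕ}

lemma four_mul_broomLines (h : s ≤ n) :
    (4 * broomLines n s : ℤ) = n ^ 2 + 4 * n + 3 + (n - 2 * s - 3) ^ 2 := by
  suffices (4 * broomLines n s : ℚ) = n ^ 2 + 4 * n + 3 + (n - 2 * s - 3) ^ 2 by exact_mod_cast this
  simp only [broomLines, Nat.cast_add, Nat.cast_choose_two, Nat.cast_sub h, Nat.cast_ofNat,
    Nat.cast_one]
  ring

lemma sq_div_four_le_broomLines (h : s ≤ n) : n ^ 2 / 4 + n + 1 ≤ broomLines n s := by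
  have hfour := four_mul_broomLines h
  have := sq_nonneg ((n : ℤ) - 2 * s - 3)
  rw [← Nat.cast_pow] at hfour
  lia

lemma sq_mod_four (n : ℕ) : n ^ 2 % 4 = n % 2 := by
  obtain ⟨c, rfl | rfl⟩ := n.even_or_odd'
  · rw [show (2 * c) ^ 2 = 4 * c ^ 2 by ring]
    lia
  · rw [show (2 * c + 1) ^ 2 = 4 * (c ^ 2 + c) + 1 by ring]
    lia

lemma broomLines_eq_iff (h : s ≤ n) :
    broomLines n s = n ^ 2 / 4 + n + 1 ↔
      (Odd n ∧ s + 1 = (n - 1) / 2) ∨ (Even n ∧ 2 ≤ n ∧ (s + 1 = n / 2 - 1 ∨ s + 1 = n / 2)) := by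
  have hfour := four_mul_broomLines h
  have hmod := sq_mod_four n
  set d : ℤ := n - 2 * s - 3 with hd
  have hexcess : broomLines n s = n ^ 2 / 4 + n + 1 ↔ d ^ 2 + (n % 2 : ℕ) = 1 := by
    rw [← Nat.cast_pow] at hfour
    lia
  rw [hexcess]
  obtain heven | hodd := n.even_or_odd
  · have hn := Nat.even_iff.1 heven
    simp only [hn, Nat.cast_zero, add_zero, sq_eq_one_iff, Nat.not_odd_iff_even.2 heven, heven,
      false_and, false_or, true_and]
    lia
  · have hn := Nat.odd_iff.1 hodd
    simp only [hn, Nat.cast_one, add_eq_right, sq_eq_zero_iff, Nat.not_even_iff_odd.2 hodd, hodd,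
      false_and, or_false, true_and]
    lia

lemma floor_sq_div_four_add (n : ℕ) : ⌊(n : ℝ) ^ 2 / 4 + n + 1⌋₊ = n ^ 2 / 4 + n + 1 := by
  have hcast : (n : ℝ) ^ 2 / 4 + n + 1 = (n ^ 2 : ℕ) / (4 : ℕ) + (n + 1 : ℕ) := by
    push_cast
    ring
  rw [hcast, Nat.floor_add_natCast (by positivity), Nat.floor_div_natCast, Nat.floor_natCast,
    add_assoc]

lemma sq_div_four_lt_choose_two (h : 7 ≤ n) : n ^ 2 / 4 + n + 1 < n.choose 2 + 1 := by
  suffices n ^ 2 + 4 * n < 4 * n.choose 2 by lia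
  suffices (n ^ 2 + 4 * n : ℚ) < 4 * n.choose 2 by exact_mod_cast this
  rw [Nat.cast_choose_two]
  have : (7 : ℚ) ≤ n := by exact_mod_cast h
  nlinarith

lemma choose_two_add_one_le_iff : n.choose 2 + 1 ≤ n ^ 2 / 4 + n + 1 ↔ n ≤ 6 := by
  refine ⟨fun hle => ?_, fun hn => by interval_cases n <;> decide⟩
  by_contra! hn
  exact hle.not_gt (sq_div_four_lt_choose_two hn)

lemma sq_div_four_le_choose_two_iff (hn : 1 ≤ n) :
    n ^ 2 / 4 + n + 1 ≤ n.choose 2 + 1 ↔ 6 ≤ n := by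
  obtain h | h := le_or_gt 7 n
  · exact iff_of_true (sq_div_four_lt_choose_two h).le (by lia)
  · interval_cases n <;> decide

end Arithmetic

section Bounds

variable {V : Type*} {T : SimpleGraph V} [Fintype V]

lemma numLines_of_isBalancedBroom (hT : T.IsTree) (w : Sym2 V → ℝ) (h6 : 6 ≤ Fintype.card V)
    (h : T.IsBalancedBroom (Fintype.card V)) :
    (T.derivedSystem w).numLines = Fintype.card V ^ 2 / 4 + Fintype.card V + 1 := by
  obtain ⟨a, ha, ⟨φ⟩⟩ := h
  have haq : 2 ≤ a ∧ a + 3 ≤ Fintype.card V := by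
    rw [Nat.odd_iff, Nat.even_iff] at ha
    lia
  obtain ⟨x, z, hbroom, hx⟩ := exists_isBroomAt_of_iso_broom (by lia) (by lia) φ
  have hs : a - 1 + 1 = a := by lia
  rw [hbroom.numLines_eq hT w (hx.trans hs.symm) (by lia), broomLines_eq_iff (by lia), hs]
  exact ha.imp_right fun ⟨heven, ha⟩ => ⟨heven, by lia, ha⟩

lemma min_le_numLines [Nontrivial V] (hT : T.IsTree) (w : Sym2 V → ℝ) :
    min ((Fintype.card V).choose 2 + 1) (Fintype.card V ^ 2 / 4 + Fintype.card V + 1) ≤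
      (T.derivedSystem w).numLines := by
  by_cases hpath : T.IsPathOn (Fintype.card V)
  · exact min_le_of_left_le (numLines_of_isPathOn hT w hpath).ge
  obtain hlt | ⟨s, hs, hle, -⟩ := lt_numLines_or_exists_broomLines_le hT w hpath
  · exact min_le_of_left_le hlt.le
  · exact min_le_of_right_le ((sq_div_four_le_broomLines hs).trans hle)

lemma isBalancedBroom_of_numLines_eq_min [Nontrivial V] (hT : T.IsTree) (w : Sym2 V → ℝ)
    (hpath : ¬ T.IsPathOn (Fintype.card V))
    (h : (T.derivedSystem w).numLines =
      min ((Fintype.card V).choose 2 + 1) (Fintype.card V ^ 2 / 4 + Fintype.card V + 1)) :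
    6 ≤ Fintype.card V ∧ T.IsBalancedBroom (Fintype.card V) := by
  obtain hlt | ⟨s, hs, hle, hiso⟩ := lt_numLines_or_exists_broomLines_le hT w hpath
  · exact absurd (h.trans_le (min_le_left _ _)) hlt.not_ge
  have hlow := sq_div_four_le_broomLines hs
  have heq : broomLines (Fintype.card V) s = Fintype.card V ^ 2 / 4 + Fintype.card V + 1 :=
    (hle.trans (h.trans_le (min_le_right _ _))).antisymm hlow
  refine ⟨(sq_div_four_le_choose_two_iff Fintype.card_pos).1 <|
    (hlow.trans hle).trans (h.trans_le (min_le_left _ _)), s + 1, ?_, hiso ?_⟩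
  · exact ((broomLines_eq_iff hs).1 heq).imp_right fun ⟨heven, _, hs⟩ => ⟨heven, hs⟩
  · exact ((h.trans_le (min_le_right _ _)).trans heq.ge).antisymm hle

lemma numLines_eq_min_iff [Nontrivial V] (hT : T.IsTree) (w : Sym2 V → ℝ) :
    (T.derivedSystem w).numLines =
      min ((Fintype.card V).choose 2 + 1) (Fintype.card V ^ 2 / 4 + Fintype.card V + 1) ↔
    (Fintype.card V ≤ 6 ∧ T.IsPathOn (Fintype.card V)) ∨
      (6 ≤ Fintype.card V ∧ T.IsBalancedBroom (Fintype.card V)) := by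
  constructor
  · intro h
    by_cases hpath : T.IsPathOn (Fintype.card V)
    · rw [numLines_of_isPathOn hT w hpath, left_eq_inf, choose_two_add_one_le_iff] at h
      exact .inl ⟨h, hpath⟩
    · exact .inr (isBalancedBroom_of_numLines_eq_min hT w hpath h)
  · rintro (⟨h6, hpath⟩ | ⟨h6, hbroom⟩)
    · rw [numLines_of_isPathOn hT w hpath, min_eq_left (choose_two_add_one_le_iff.2 h6)]
    · rw [numLines_of_isBalancedBroom hT w h6 hbroom,
        min_eq_right ((sq_div_four_le_choose_two_iff Fintype.card_pos).2 h6)]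

end Bounds

end TreeLines

theorem mainTheorem1_general {V : Type*} [Fintype V] (T : SimpleGraph V) (hT : T.IsTree)
    (w : Sym2 V → ℝ) (n : ℕ) (hn : Fintype.card V = n) (hn2 : 2 ≤ n) :
    (6 ≤ n →
      ⌊(n : ℝ) ^ 2 / 4 + n + 1⌋₊ ≤ (T.derivedSystem w).numLines ∧
      ((T.derivedSystem w).numLines = ⌊(n : ℝ) ^ 2 / 4 + n + 1⌋₊ ↔
        (n ≤ 6 ∧ T.IsPathOn n) ∨ (6 ≤ n ∧ T.IsBalancedBroom n))) ∧
    (n ≤ 6 →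
      n.choose 2 + 1 ≤ (T.derivedSystem w).numLines ∧
      ((T.derivedSystem w).numLines = n.choose 2 + 1 ↔
        (n ≤ 6 ∧ T.IsPathOn n) ∨ (6 ≤ n ∧ T.IsBalancedBroom n))) := by
  subst hn
  have : Nontrivial V := Fintype.one_lt_card_iff_nontrivial.1 hn2
  have hmin := TreeLines.min_le_numLines hT w
  have hiff := TreeLines.numLines_eq_min_iff hT w
  rw [TreeLines.floor_sq_div_four_add]
  refine ⟨fun h6 => ?_, fun h6 => ?_⟩
  · rw [min_eq_right ((TreeLines.sq_div_four_le_choose_two_iff Fintype.card_pos).2 h6)] at hmin hiff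
    exact ⟨hmin, hiff⟩
  · rw [min_eq_left (TreeLines.choose_two_add_one_le_iff.2 h6)] at hmin hiff
    exact ⟨hmin, hiff⟩

theorem mainTheorem1 {V : Type*} [Fintype V] (T : SimpleGraph V) (hT : T.IsTree)
    (w : Sym2 V → ℝ) (hw : ∀ e ∈ T.edgeSet, 0 < w e)
    (n : ℕ) (hn : Fintype.card V = n) (hn3 : 3 ≤ n) :
    (6 ≤ n →
      ⌊(n : ℝ) ^ 2 / 4 + n + 1⌋₊ ≤ (T.derivedSystem w).numLines ∧
      ((T.derivedSystem w).numLines = ⌊(n : ℝ) ^ 2 / 4 + n + 1⌋₊ ↔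
        (n ≤ 6 ∧ T.IsPathOn n) ∨ (6 ≤ n ∧ T.IsBalancedBroom n))) ∧
    (n ≤ 6 →
      n.choose 2 + 1 ≤ (T.derivedSystem w).numLines ∧
      ((T.derivedSystem w).numLines = n.choose 2 + 1 ↔
        (n ≤ 6 ∧ T.IsPathOn n) ∨ (6 ≤ n ∧ T.IsBalancedBroom n))) :=
  mainTheorem1_general T hT w n hn (by lia)
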